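/- Let $G=(V,E)$ be a finite simple graph without isolated edges, i.e. no connected component of $G$ is a $K_2$. Then $G$ can be decomposed into (at most) $24$ subgraphs fulfilling the 1--2--3 Conjecture. That is, $E$ can be partitioned into $24$ pairwise disjoint, possibly empty sets $E_1,\dots,E_{24}$ such that for every $i\in\{1,\dots,24\}$ there is a weighting $\omega_i:E_i\to\{1,2,3\}$ with $$\sum_{e\in E_i,\; u\in e}\omega_i(e)\;\neq\;\sum_{e\in E_i,\; v\in e}\omega_i(e)\qquad\text{for every edge } uv\in E_i.$$ -/

import Mathlib

namespace OneTwoThree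

/-- `G` has no isolated edge: there is no edge `uv` such that `v` is the only neighbour of `u`
and `u` is the only neighbour of `v` (that is, `G` has no `K₂`-component). -/
def NoIsolatedEdges {V : Type*} (G : SimpleGraph V) : Prop :=
  ¬ ∃ u v : V, G.Adj u v ∧ (∀ w, G.Adj u w → w = v) ∧ (∀ w, G.Adj v w → w = u)

/-- The sum at the vertex `v` of the weights `ω e` over all edges `e` of `G` incident with `v`
(for graphs in which every vertex has finite degree). -/
noncomputable def weightedDegree {V : Type*} (G : SimpleGraph V) (ω : Sym2 V → ℕ) (v : V) : ℕ :=
  ∑ᶠ e ∈ G.incidenceSet v, ω e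

/-- `G` fulfills the 1-2-3 Conjecture: it has an edge weighting with weights `1, 2, 3` for which
adjacent vertices have distinct sums. Only the values of `ω` on the edges of `G` matter. -/
def Fulfills123 {V : Type*} (G : SimpleGraph V) : Prop :=
  ∃ ω : Sym2 V → ℕ, (∀ e ∈ G.edgeSet, ω e = 1 ∨ ω e = 2 ∨ ω e = 3) ∧
    ∀ u v : V, G.Adj u v → weightedDegree G ω u ≠ weightedDegree G ω v

/-- The family `H` of graphs on the vertex set of `G` is a decomposition of `G`: the edge sets
of its members are pairwise disjoint and their union is the edge set of `G` (some members may be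
edgeless). -/
def IsDecomposition {V ι : Type*} (G : SimpleGraph V) (H : ι → SimpleGraph V) : Prop :=
  (∀ i j : ι, i ≠ j → Disjoint (H i).edgeSet (H j).edgeSet) ∧
    (⋃ i, (H i).edgeSet) = G.edgeSet

end OneTwoThree

/-!
The graph splits into `17` graphs fulfilling the 1-2-3 Conjecture; the other seven members of the
decomposition are edgeless.

Two kinds of graphs are weighted directly. The first kind (`fulfills123_of_independent_compl`) has a
set `S` of vertices such that no edge avoids `S` and every `s ∈ S` either has at least `4 d + 3`
neighbours outside `S`, where `d` counts those inside, or has `d = 0` and is not an end of an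
isolated edge. Its vertices in `S` are treated one after another. Every vertex `t ∉ S` of degree `k`
keeps its running sum within a window of two consecutive values, in such a way that its final sum is
not `1` modulo `4`, whereas the sums on `S` are chosen to be `1` modulo `4` (with small exceptions)
and different from those of the earlier neighbours in `S`. In particular every bipartite graph
without isolated edges is of this kind. The second kind (`fulfills123_of_zmod_coloring`) is a
`3`-colourable graph all of whose components are non-bipartite: alternating weights along odd closed
walks realize any prescribed sums modulo `3`, for instance a proper colouring.

To split `G`, choose an independent set `I` such that the edges meeting `I` connect every component
of `G` (`exists_connecting_independent_set`). The graph induced on the complement of `I` is coloured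
with `15` colours so that no vertex has more neighbours in its own colour class than in another one.
Each bichromatic edge is given to one of its ends, so that a vertex with `d > 0` neighbours in its
own class receives at least `7 d ≥ 4 d + 3` edges. The edges inside a colour class together with the
edges given to its vertices form a graph of the first kind, provided that one sets aside the edges
given to vertices that have `d = 0` and receive a single edge; the graph `K` of the edges set aside
is bipartite (`exists_decomposition_bipartite_rest`).

Finally the union of `K` and the edges meeting `I` is `3`-colourable. Its non-bipartite components
form a graph of the second kind. An edge of `K` has both ends outside `I`, and these are joined by an
even walk of edges meeting `I`, so the bipartite components consist of edges meeting `I`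
only. Such a component has the same vertices as a component of `G`, so it is not an isolated edge,
and these components form a bipartite graph of the first kind.
-/

namespace OneTwoThree

open Finset

section
open scoped Classical

/-! ### Decompositions -/

lemma isDecomposition_of_adj {V ι : Type*} {G : SimpleGraph V} {H : ι → SimpleGraph V}
    (hle : ∀ i u v, (H i).Adj u v → G.Adj u v) (hex : ∀ u v, G.Adj u v → ∃ i, (H i).Adj u v)
    (huniq : ∀ i j u v, (H i).Adj u v → (H j).Adj u v → i = j) : IsDecomposition G H := by
  refine ⟨fun i j hij => Set.disjoint_left.2 fun e => ?_, ?_⟩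
  · induction e with | _ u v =>
    exact fun h1 h2 => hij (huniq i j u v h1 h2)
  · ext e
    induction e with | _ u v =>
    simp only [Set.mem_iUnion, SimpleGraph.mem_edgeSet]
    exact ⟨fun ⟨i, h⟩ => hle i u v h, hex u v⟩

lemma fulfills123_bot {V : Type*} : Fulfills123 (⊥ : SimpleGraph V) :=
  ⟨fun _ => 1, by simp, by simp⟩

/-- A decomposition with fewer members is padded by edgeless graphs. -/
lemma exists_fin_decomposition {V ι : Type*} [Fintype ι] {n : ℕ} (hn : Fintype.card ι ≤ n)
    {G : SimpleGraph V} {H : ι → SimpleGraph V} (hH : IsDecomposition G H)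
    (hf : ∀ i, Fulfills123 (H i)) :
    ∃ H' : Fin n → SimpleGraph V, IsDecomposition G H' ∧ ∀ i, Fulfills123 (H' i) := by
  obtain ⟨e⟩ := Function.Embedding.nonempty_of_card_le (α := ι) (β := Fin n) (by simpa using hn)
  have hnot : ∀ j, (¬ ∃ i, e i = j) → Function.extend e H (fun _ => ⊥) j = ⊥ := fun j hj =>
    Function.extend_apply' _ _ _ hj
  have hmem : ∀ i, Function.extend e H (fun _ => ⊥) (e i) = H i := fun i =>
    e.injective.extend_apply _ _ _
  refine ⟨Function.extend e H fun _ => ⊥, ⟨fun j k hjk => ?_, ?_⟩, fun j => ?_⟩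
  · by_cases hj : ∃ i, e i = j
    · by_cases hk : ∃ i, e i = k
      · obtain ⟨i, rfl⟩ := hj
        obtain ⟨i', rfl⟩ := hk
        rw [hmem, hmem]
        exact hH.1 i i' fun h => hjk (h ▸ rfl)
      · rw [hnot k hk]
        simp
    · rw [hnot j hj]
      simp
  · rw [← hH.2]
    apply subset_antisymm
    · refine Set.iUnion_subset fun j => ?_
      by_cases hj : ∃ i, e i = j
      · obtain ⟨i, rfl⟩ := hj
        rw [hmem]
        exact Set.subset_iUnion (fun i => (H i).edgeSet) i
      · rw [hnot j hj]
        simp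
    · refine Set.iUnion_subset fun i => ?_
      rw [← hmem i]
      exact Set.subset_iUnion (fun j => (Function.extend e H (fun _ => ⊥) j).edgeSet) (e i)
  · by_cases hj : ∃ i, e i = j
    · obtain ⟨i, rfl⟩ := hj
      rw [hmem]
      exact hf i
    · rw [hnot j hj]
      exact fulfills123_bot

/-! ### Graphs with an independent side -/

variable {V : Type*} [Fintype V]

lemma weightedDegree_eq_sum (G : SimpleGraph V) (ω : Sym2 V → ℕ) (v : V) :
    weightedDegree G ω v = ∑ x with G.Adj v x, ω s(v, x) := by
  have h : G.incidenceSet v = (fun x => s(v, x)) '' ((univ.filter (G.Adj v) : Finset V) : Set V) := by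
    ext e
    induction e with | _ a b =>
    simp only [SimpleGraph.mk'_mem_incidenceSet_iff, coe_filter, mem_univ, true_and, Set.mem_image,
      Set.mem_ofPred_eq, Sym2.eq_iff]
    constructor
    · rintro ⟨hab, rfl | rfl⟩
      · exact ⟨b, hab, Or.inl ⟨rfl, rfl⟩⟩
      · exact ⟨a, hab.symm, Or.inr ⟨rfl, rfl⟩⟩
    · rintro ⟨x, hx, ⟨rfl, rfl⟩ | ⟨rfl, rfl⟩⟩
      · exact ⟨hx, Or.inl rfl⟩
      · exact ⟨hx.symm, Or.inr rfl⟩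
  unfold weightedDegree
  rw [h, finsum_mem_image, finsum_mem_coe_finset]
  exact fun x _ y _ hxy => Sym2.congr_right.1 hxy

lemma fulfills123_of_symm_weight (G : SimpleGraph V) (w : V → V → ℕ)
    (hsymm : ∀ u v, w u v = w v u)
    (hw : ∀ u v, G.Adj u v → w u v = 1 ∨ w u v = 2 ∨ w u v = 3)
    (hne : ∀ u v, G.Adj u v → ∑ x with G.Adj u x, w u x ≠ ∑ x with G.Adj v x, w v x) :
    Fulfills123 G := by
  refine ⟨Sym2.lift ⟨w, hsymm⟩, ?_, ?_⟩
  · intro e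
    induction e with | _ a b =>
    exact hw a b
  · intro u v huv
    simpa [weightedDegree_eq_sum] using hne u v huv

/-- Among the `n + 1` consecutive values `a, …, a + n` with `n ≥ 4 d + 3`, at least `d + 1` are
`1` modulo `4`, so one of these avoids any `d` forbidden values. -/
lemma exists_shift_mod_four {a d n : ℕ} (hn : 4 * d + 3 ≤ n) (F : Finset ℕ) (hF : #F ≤ d) :
    ∃ j ≤ n, (a + j) % 4 = 1 ∧ a + j ∉ F := by
  have hcard : #F < #((range (d + 1)).image fun i => a + ((a * 3 + 1) % 4 + 4 * i)) := by
    rw [card_image_of_injective _ (fun x y h => by simpa using h), card_range]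
    omega
  obtain ⟨x, hx, hxF⟩ := exists_mem_notMem_of_card_lt_card hcard
  obtain ⟨i, hi, rfl⟩ := mem_image.1 hx
  have := mem_range.1 hi
  exact ⟨_, by omega, by omega, hxF⟩

/-- The sum that a vertex of the special side takes: `a` is its smallest available sum, `n` its
number of edges to the other side, `d` its degree inside its own side, and `F` the set of sums of
its neighbours that are already treated. -/
lemma exists_target {a d n : ℕ} (F : Finset ℕ) (hF : #F ≤ d)
    (h : 4 * d + 3 ≤ n ∨ d = 0) (ha : d = 0 → n ≤ a ∧ a ≤ 2 * n) :
    ∃ j ≤ n, (2 ≤ n + d → (a + j) % 4 = 1 ∨ a + j = 2) ∧ a + j ∉ F := by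
  by_cases hn : 4 * d + 3 ≤ n
  · obtain ⟨j, hj, h1, h2⟩ := exists_shift_mod_four (a := a) hn F hF
    exact ⟨j, hj, fun _ => Or.inl h1, h2⟩
  · obtain rfl : d = 0 := by tauto
    obtain rfl : F = ∅ := by simpa using hF
    obtain ⟨h1, h2⟩ := ha rfl
    -- two edges whose smaller options add up to `a`: aim for the sum `2` or `5`
    by_cases ha2 : a = 2
    · exact ⟨0, by omega, by omega, by simp⟩
    · by_cases hn2 : n = 2
      · exact ⟨5 - a, by omega, by omega, by simp⟩
      · exact ⟨0, by omega, by omega, by simp⟩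

/-- If every `t ∈ B` may take one of two consecutive values, every sum between the two extreme sums
is attained. -/
lemma exists_sum_between {V : Type*} (B : Finset V) (b : V → ℕ) {j : ℕ} (hj : j ≤ #B) :
    ∃ g : V → ℕ, (∀ t, g t = b t ∨ g t = b t + 1) ∧ ∑ t ∈ B, g t = ∑ t ∈ B, b t + j := by
  obtain ⟨J, hJB, rfl⟩ := exists_subset_card_eq hj
  refine ⟨fun t => b t + if t ∈ J then 1 else 0, fun t => ?_, ?_⟩
  · by_cases h : t ∈ J <;> simp [h]
  · rw [sum_add_distrib, sum_ite_mem, inter_eq_right.2 hJB]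
    simp

/-- The edges leaving `S` can be weighted while the vertices of `S` are treated one after another.
Here `P` is the set of vertices treated so far and `w s t` is the weight of the edge from `s ∈ S` to
`t ∉ S`; edges inside `S` have weight `1`, so they contribute their number to the sum at `s`.
The running sum at `t`, shifted by `ε t`, is `2 n` or `2 n + 1` when `n` neighbours of `t` have been
treated. Each new edge can therefore take two consecutive weights, `{1, 2}` or `{2, 3}`, and the
sum at the vertex being treated ranges over an interval. -/
lemma exists_sequential_weight (G : SimpleGraph V) (S : Set V)
    (hdeg : ∀ s ∈ S, 4 * #{x | G.Adj s x ∧ x ∈ S} + 3 ≤ #{x | G.Adj s x ∧ x ∉ S} ∨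
      #{x | G.Adj s x ∧ x ∈ S} = 0)
    (ε : V → ℕ) (hε : ∀ t, ε t ≤ 1) (P : Finset V) (hP : ∀ s ∈ P, s ∈ S) :
    ∃ w : V → V → ℕ,
      (∀ s ∈ P, ∀ t, w s t = 1 ∨ w s t = 2 ∨ w s t = 3) ∧
      (∀ t, ∑ s ∈ P with G.Adj s t, w s t + ε t = 2 * #{s ∈ P | G.Adj s t} ∨
        ∑ s ∈ P with G.Adj s t, w s t + ε t = 2 * #{s ∈ P | G.Adj s t} + 1) ∧
      (∀ s ∈ P, 2 ≤ #{x | G.Adj s x ∧ x ∉ S} + #{x | G.Adj s x ∧ x ∈ S} →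
        (#{x | G.Adj s x ∧ x ∈ S} + ∑ x with G.Adj s x ∧ x ∉ S, w s x) % 4 = 1 ∨
        #{x | G.Adj s x ∧ x ∈ S} + ∑ x with G.Adj s x ∧ x ∉ S, w s x = 2) ∧
      (∀ s ∈ P, ∀ s' ∈ P, G.Adj s s' →
        #{x | G.Adj s x ∧ x ∈ S} + ∑ x with G.Adj s x ∧ x ∉ S, w s x ≠
        #{x | G.Adj s' x ∧ x ∈ S} + ∑ x with G.Adj s' x ∧ x ∉ S, w s' x) := by
  induction P using Finset.induction_on with
  | empty =>
    refine ⟨fun _ _ => 0, by simp, fun t => ?_, by simp, by simp⟩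
    have := hε t
    simp only [filter_empty, sum_empty, card_empty]
    omega
  | insert s P hs ih =>
    obtain ⟨w, hw, hwin, hres, hne⟩ := ih fun x hx => hP x (mem_insert_of_mem hx)
    have hsS := hP s (mem_insert_self _ _)
    let σ : V → ℕ := fun s' => #{x | G.Adj s' x ∧ x ∈ S} + ∑ x with G.Adj s' x ∧ x ∉ S, w s' x
    -- the smaller of the two options for the edge `st` that keep `t` inside its window
    let b : V → ℕ := fun t =>
      if ∑ s ∈ P with G.Adj s t, w s t + ε t = 2 * #{s ∈ P | G.Adj s t} then 2 else 1
    have hb : ∀ t, 1 ≤ b t ∧ b t ≤ 2 := fun t => by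
      by_cases h : ∑ s ∈ P with G.Adj s t, w s t + ε t = 2 * #{s ∈ P | G.Adj s t} <;> simp [b, h]
    let F : Finset ℕ := ({x ∈ P | G.Adj s x}).image σ
    have hF : #F ≤ #{x | G.Adj s x ∧ x ∈ S} := by
      refine card_image_le.trans (card_le_card fun x hx => ?_)
      simp only [mem_filter, mem_univ, true_and] at hx ⊢
      exact ⟨hx.2, hP x (mem_insert_of_mem hx.1)⟩
    obtain ⟨j, hj, hj1, hj2⟩ := exists_target
      (a := #{x | G.Adj s x ∧ x ∈ S} + ∑ x with G.Adj s x ∧ x ∉ S, b x) F hF (hdeg s hsS) (by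
        intro h0
        have h1 : #{x | G.Adj s x ∧ x ∉ S} • 1 ≤ ∑ x with G.Adj s x ∧ x ∉ S, b x :=
          card_nsmul_le_sum _ b 1 fun x _ => (hb x).1
        have h2 : ∑ x with G.Adj s x ∧ x ∉ S, b x ≤ #{x | G.Adj s x ∧ x ∉ S} • 2 :=
          sum_le_card_nsmul _ b 2 fun x _ => (hb x).2
        simp only [smul_eq_mul] at h1 h2
        omega)
    obtain ⟨g, hg, hgsum⟩ := exists_sum_between {x | G.Adj s x ∧ x ∉ S} b hj
    have hself : Function.update w s g s = g := Function.update_self ..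
    have hother : ∀ x ∈ P, Function.update w s g x = w x := fun x hx =>
      Function.update_of_ne (by rintro rfl; exact hs hx) ..
    have hsum : #{x | G.Adj s x ∧ x ∈ S} + ∑ x with G.Adj s x ∧ x ∉ S, g x ∉ F := by
      rw [hgsum, ← add_assoc]; exact hj2
    refine ⟨Function.update w s g, ?_, ?_, ?_, ?_⟩
    · intro x hx t
      rcases mem_insert.1 hx with rfl | hx
      · rw [hself]
        have := hb t
        have := hg t
        omega
      · rw [hother x hx]
        exact hw x hx t
    · intro t
      have hcongr : ∑ x ∈ P with G.Adj x t, Function.update w s g x t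
          = ∑ x ∈ P with G.Adj x t, w x t :=
        sum_congr rfl fun x hx => by rw [hother x (mem_filter.1 hx).1]
      by_cases hst : G.Adj s t
      · rw [filter_insert, if_pos hst, sum_insert (by simp [hs]), card_insert_of_notMem (by simp [hs]),
          hcongr, hself]
        have h1 := hg t
        have h2 := hwin t
        by_cases h : ∑ s ∈ P with G.Adj s t, w s t + ε t = 2 * #{s ∈ P | G.Adj s t}
        · have : b t = 2 := if_pos h
          omega
        · have : b t = 1 := if_neg h
          omega
      · rw [filter_insert, if_neg hst, hcongr]
        exact hwin t
    · intro x hx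
      rcases mem_insert.1 hx with rfl | hx
      · rw [hself, hgsum, ← add_assoc]
        exact hj1
      · rw [hother x hx]
        exact hres x hx
    · intro x hx y hy hxy
      rcases mem_insert.1 hx with hx' | hx' <;> rcases mem_insert.1 hy with hy' | hy'
      · exact (G.ne_of_adj hxy (hx'.trans hy'.symm)).elim
      · subst hx'
        rw [hself, hother y hy']
        intro h
        exact hsum (mem_image.2 ⟨y, by simp [hy', hxy], h.symm⟩)
      · subst hy'
        rw [hself, hother x hx']
        intro h
        exact hsum (mem_image.2 ⟨x, by simp [hx', hxy.symm], h⟩)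
      · rw [hother x hx', hother y hy']
        exact hne x hx' y hy' hxy

/-- The main source of graphs fulfilling the 1-2-3 Conjecture: no edge avoids `S`, and a vertex of
`S` either has many more neighbours outside `S` than inside, or has no neighbour in `S`, where in
addition it is not an end of an isolated edge.

Vertices of `S` of degree at least two get sums that are `1` modulo `4` or equal to `2`. A vertex
`t ∉ S` of degree `k ≥ 2` gets `2 k` or `2 k + 1` if `k` is odd and `2 k - 1` or `2 k` if `k` is even,
which is never of that form. Vertices of degree one cause no conflict, as their neighbour has a
second edge. -/
theorem fulfills123_of_independent_compl (G : SimpleGraph V) (S : Set V)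
    (hT : ∀ u v, G.Adj u v → u ∈ S ∨ v ∈ S)
    (hdeg : ∀ s ∈ S, 4 * #{x | G.Adj s x ∧ x ∈ S} + 3 ≤ #{x | G.Adj s x ∧ x ∉ S} ∨
      (#{x | G.Adj s x ∧ x ∈ S} = 0 ∧ (#{x | G.Adj s x ∧ x ∉ S} = 1 →
        ∀ t, G.Adj s t → 2 ≤ #{x | G.Adj t x}))) :
    Fulfills123 G := by
  obtain ⟨w, hw, hwin, hres, hne⟩ := exists_sequential_weight G S
    (fun s hs => (hdeg s hs).imp_right And.left)
    (fun t => if Even #{x | G.Adj t x} then 1 else 0) (fun t => by split_ifs <;> simp)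
    (univ.filter (· ∈ S)) (by simp)
  simp only [mem_filter, mem_univ, true_and] at hw hres hne
  let f : V → V → ℕ := fun u v =>
    if u ∈ S then (if v ∈ S then 1 else w u v) else (if v ∈ S then w v u else 1)
  have hf : ∀ u v, f u v = f v u := by
    intro u v
    by_cases hu : u ∈ S <;> by_cases hv : v ∈ S <;> simp [f, hu, hv]
  have hf3 : ∀ u v, f u v = 1 ∨ f u v = 2 ∨ f u v = 3 := by
    intro u v
    by_cases hu : u ∈ S <;> by_cases hv : v ∈ S <;> simp [f, hu, hv]
    · exact hw u hu v
    · exact hw v hv u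
  have hS : ∀ s ∈ S, ∑ x with G.Adj s x, f s x =
      #{x | G.Adj s x ∧ x ∈ S} + ∑ x with G.Adj s x ∧ x ∉ S, w s x := by
    intro s hs
    rw [← sum_filter_add_sum_filter_not _ (· ∈ S), filter_filter, filter_filter, card_eq_sum_ones]
    congr 1
    · exact sum_congr rfl fun x hx => by
        have := (mem_filter.1 hx).2.2
        simp [f, hs, this]
    · exact sum_congr rfl fun x hx => by
        have := (mem_filter.1 hx).2.2
        simp [f, hs, this]
  have hTset : ∀ t ∉ S, ((univ.filter (· ∈ S)).filter (G.Adj · t)) = ({x | G.Adj t x} : Finset V) := by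
    intro t ht
    ext x
    simp only [mem_filter, mem_univ, true_and, G.adj_comm x t]
    exact ⟨And.right, fun h => ⟨(hT t x h).resolve_left ht, h⟩⟩
  have hTsum : ∀ t ∉ S, ∑ x with G.Adj t x, f t x =
      ∑ s ∈ univ.filter (· ∈ S) with G.Adj s t, w s t := by
    intro t ht
    rw [hTset t ht]
    refine sum_congr rfl fun x hx => ?_
    have : x ∈ S := (hT t x (mem_filter.1 hx).2).resolve_left ht
    simp [f, ht, this]
  -- a vertex of degree at least two beats each of its edges
  have hbig : ∀ u v, G.Adj u v → 2 ≤ #{x | G.Adj u x} → f u v < ∑ x with G.Adj u x, f u x := by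
    intro u v huv h2
    obtain ⟨y, hy, hyv⟩ := exists_mem_ne (by omega : 1 < #{x | G.Adj u x}) v
    refine single_lt_sum hyv (by simpa using huv) hy ?_ fun _ _ _ => Nat.zero_le _
    have := hf3 u y
    omega
  have hsingle : ∀ u v, G.Adj u v → #{x | G.Adj u x} = 1 → ∑ x with G.Adj u x, f u x = f u v := by
    intro u v huv h1
    obtain ⟨y, hy⟩ := card_eq_one.1 h1
    have : v ∈ ({x | G.Adj u x} : Finset V) := by simpa using huv
    rw [hy] at this ⊢
    rw [mem_singleton.1 this, sum_singleton]
  have hST : ∀ s t, G.Adj s t → s ∈ S → t ∉ S →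
      ∑ x with G.Adj s x, f s x ≠ ∑ x with G.Adj t x, f t x := by
    intro s t hst hs ht
    have hsdeg : #{x | G.Adj s x} = #{x | G.Adj s x ∧ x ∉ S} + #{x | G.Adj s x ∧ x ∈ S} := by
      rw [← card_filter_add_card_filter_not (s := {x | G.Adj s x}) (· ∈ S), filter_filter,
        filter_filter, add_comm]
    have hspos : 1 ≤ #{x | G.Adj s x ∧ x ∉ S} := card_pos.2 ⟨t, by simp [hst, ht]⟩
    have htpos : 1 ≤ #{x | G.Adj t x} := card_pos.2 ⟨s, by simp [hst.symm]⟩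
    by_cases h1 : #{x | G.Adj s x} = 1
    · have := (hdeg s hs).resolve_left (by omega)
      have := hbig t s hst.symm (this.2 (by omega) t hst)
      rw [hsingle s t hst h1, hf s t]
      exact this.ne
    · by_cases h2 : #{x | G.Adj t x} = 1
      · rw [hsingle t s hst.symm h2, hf t s]
        exact (hbig s t hst (by omega)).ne'
      · rw [hTsum t ht, hS s hs]
        have h3 := hres s hs (by omega)
        have h4 := hwin t
        rw [hTset t ht] at h4 ⊢
        by_cases he : Even #{x | G.Adj t x}
        · rw [if_pos he] at h4
          obtain ⟨m, hm⟩ := he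
          omega
        · rw [if_neg he] at h4
          obtain ⟨m, hm⟩ := Nat.not_even_iff_odd.1 he
          omega
  refine fulfills123_of_symm_weight G f hf (fun u v _ => hf3 u v) fun u v huv => ?_
  by_cases hu : u ∈ S <;> by_cases hv : v ∈ S
  · rw [hS u hu, hS v hv]
    exact hne u hu v hv huv
  · exact hST u v huv hu hv
  · exact (hST v u huv.symm hv hu).symm
  · exact ((hT u v huv).elim hu hv).elim

lemma fulfills123_of_bipartite {V : Type*} [Finite V] (G : SimpleGraph V) (S : Set V)
    (hS : ∀ u v, G.Adj u v → (u ∈ S ↔ v ∉ S)) (hG : NoIsolatedEdges G) : Fulfills123 G := by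
  have := Fintype.ofFinite V
  refine fulfills123_of_independent_compl G S
    (fun u v huv => by have := hS u v huv; tauto) fun s hs => Or.inr ⟨?_, fun h1 t hst => ?_⟩
  · rw [card_eq_zero, filter_eq_empty_iff]
    exact fun x _ hx => (hS s x hx.1).1 hs hx.2
  · have ht : t ∉ S := (hS s t hst).1 hs
    by_contra! h2
    refine hG ⟨s, t, hst, fun w hw => ?_, fun w hw => ?_⟩
    · exact card_le_one.1 h1.le w (by simp [hw, (hS s w hw).1 hs]) t (by simp [hst, ht])
    · exact card_le_one.1 (Nat.le_of_lt_succ h2) w (by simp [hw]) s (by simp [hst.symm])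

/-! ### Three-colourable graphs with odd closed walks -/

/-- Weights alternating between `1` and `-1` along a walk from `u` to `v` have vertex sums zero away
from the ends of the walk. A closed walk of odd length changes the sum at its base vertex only,
by `2`. -/
lemma exists_boundary_of_walk {R : Type*} [CommRing R] {G : SimpleGraph V} {u v : V}
    (p : G.Walk u v) :
    ∃ δ : Sym2 V → R, ∀ x, ∑ y with G.Adj x y, δ s(x, y) =
      (if x = u then 1 else 0) - (-1) ^ p.length * (if x = v then 1 else 0) := by
  induction p with
  | nil => exact ⟨0, fun x => by simp⟩
  | @cons a b c hab p ih =>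
    obtain ⟨δ, hδ⟩ := ih
    refine ⟨fun e => (if e = s(a, b) then 1 else 0) - δ e, fun x => ?_⟩
    have hedge : ∑ y with G.Adj x y, (if s(x, y) = s(a, b) then (1 : R) else 0) =
        (if x = a then 1 else 0) + (if x = b then 1 else 0) := by
      have hne := hab.ne
      by_cases hxa : x = a
      · subst hxa
        simp [hne, hab]
      · by_cases hxb : x = b
        · subst hxb
          have : ∀ y, (y = a ↔ a = y) := fun y => eq_comm
          simp [hne.symm, hab.symm]
        · simp [hxa, hxb]
    rw [sum_sub_distrib, hedge, hδ, SimpleGraph.Walk.length_cons]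
    ring

/-- Modulo `3`, where `2` is invertible, the sums can be prescribed at all vertices that lie on a
closed walk of odd length. -/
lemma exists_zmod_weight (G : SimpleGraph V) (c : V → ZMod 3) :
    ∃ f : Sym2 V → ZMod 3, ∀ v, (∃ p : G.Walk v v, Odd p.length) →
      ∑ y with G.Adj v y, f s(v, y) = c v := by
  have h : ∀ v, ∃ δ : Sym2 V → ZMod 3, (∃ p : G.Walk v v, Odd p.length) →
      ∀ x, ∑ y with G.Adj x y, δ s(x, y) = if x = v then 1 else 0 := by
    intro v
    by_cases hv : ∃ p : G.Walk v v, Odd p.length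
    · obtain ⟨p, hp⟩ := hv
      obtain ⟨δ, hδ⟩ := exists_boundary_of_walk (R := ZMod 3) p
      refine ⟨fun e => 2 * δ e, fun _ x => ?_⟩
      rw [← mul_sum, hδ, hp.neg_one_pow]
      split_ifs
      · decide
      · simp
    · exact ⟨0, fun h => (hv h).elim⟩
  choose δ hδ using h
  refine ⟨fun e => ∑ v with ∃ p : G.Walk v v, Odd p.length, c v * δ v e, fun v hv => ?_⟩
  rw [sum_comm]
  have : ∀ u ∈ ({v | ∃ p : G.Walk v v, Odd p.length} : Finset V),
      ∑ y with G.Adj v y, c u * δ u s(v, y) = if v = u then c u else 0 := by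
    intro u hu
    rw [← mul_sum, hδ u (mem_filter.1 hu).2]
    split_ifs <;> simp
  rw [sum_congr rfl this, sum_ite_eq, if_pos (by simpa using hv)]

/-- The set of vertices lying on a closed walk of odd length, that is, the union of the
non-bipartite connected components. -/
def oddPart {V : Type*} (G : SimpleGraph V) : Set V := {v | ∃ p : G.Walk v v, Odd p.length}

lemma mem_oddPart_of_adj {V : Type*} {G : SimpleGraph V} {u v : V} (h : G.Adj u v)
    (hu : u ∈ oddPart G) :
    v ∈ oddPart G := by
  obtain ⟨p, hp⟩ := hu
  refine ⟨SimpleGraph.Walk.cons h.symm (p.append (SimpleGraph.Walk.cons h .nil)), ?_⟩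
  simp only [SimpleGraph.Walk.length_cons, SimpleGraph.Walk.length_append,
    SimpleGraph.Walk.length_nil]
  grind

/-- The union of the non-bipartite components of a `3`-colourable graph fulfills the 1-2-3
Conjecture: the sums can be made congruent to a proper colouring by `ZMod 3`. -/
theorem fulfills123_of_zmod_coloring (G H : SimpleGraph V) (c : V → ZMod 3)
    (hc : ∀ u v, G.Adj u v → c u ≠ c v)
    (hH : ∀ u v, H.Adj u v ↔ G.Adj u v ∧ u ∈ oddPart G) :
    Fulfills123 H := by
  obtain ⟨f, hf⟩ := exists_zmod_weight G c
  -- the residues modulo `3` are represented by the weights `1, 2, 3`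
  let lift : ZMod 3 → ℕ := fun r => if r = 0 then 3 else r.val
  have hlift : ∀ r, ((lift r : ℕ) : ZMod 3) = r := by decide
  have hlift3 : ∀ r, lift r = 1 ∨ lift r = 2 ∨ lift r = 3 := by decide
  have hsum : ∀ u ∈ oddPart G, ((∑ y with H.Adj u y, lift (f s(u, y)) : ℕ) : ZMod 3) = c u := by
    intro u hu
    rw [Nat.cast_sum, ← hf u hu]
    simp only [hlift, hH, hu, and_true]
  refine fulfills123_of_symm_weight H (fun u v => lift (f s(u, v)))
    (fun u v => by rw [Sym2.eq_swap]) (fun u v _ => hlift3 _) fun u v huv h => ?_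
  have hu := ((hH u v).1 huv).2
  have hv := ((hH v u).1 huv.symm).2
  apply hc u v ((hH u v).1 huv).1
  rw [← hsum u hu, ← hsum v hv, h]

/-! ### Colour classes and owned edges -/

/-- A vertex colouring with the fewest monochromatic edges: no vertex can improve by changing its
colour, so it has at least as many neighbours in any other colour class as in its own. -/
lemma exists_coloring_card_le (G : SimpleGraph V) (k : ℕ) [NeZero k] :
    ∃ col : V → Fin k, ∀ v c,
      #{x | G.Adj v x ∧ col x = col v} ≤ #{x | G.Adj v x ∧ col x = c} := by
  let g : (V → Fin k) → V → V → ℕ := fun col u x => if G.Adj u x ∧ col x = col u then 1 else 0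
  obtain ⟨col, hcol⟩ := Finite.exists_min fun col : V → Fin k => ∑ u, ∑ x, g col u x
  refine ⟨col, fun v c => ?_⟩
  by_cases hc : c = col v
  · rw [hc]
  have hsplit : ∀ col, ∑ u, ∑ x, g col u x =
      2 * ∑ x, g col v x + ∑ u ∈ univ.erase v, ∑ x ∈ univ.erase v, g col u x := by
    intro col
    have h1 : ∀ u, g col u v = g col v u := fun u => by simp only [g, G.adj_comm u v, eq_comm]
    have h2 : g col v v = 0 := by simp [g]
    have h3 : ∑ u ∈ univ.erase v, g col u v = ∑ x, g col v x := by
      rw [← add_sum_erase univ _ (mem_univ v), h2, zero_add]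
      exact sum_congr rfl fun u _ => h1 u
    rw [← add_sum_erase univ _ (mem_univ v),
      sum_congr rfl fun u _ => (add_sum_erase univ (g col u) (mem_univ v)).symm, sum_add_distrib, h3]
    ring
  have hmin := hcol (Function.update col v c)
  rw [hsplit col, hsplit (Function.update col v c)] at hmin
  have hrest : ∑ u ∈ univ.erase v, ∑ x ∈ univ.erase v, g (Function.update col v c) u x =
      ∑ u ∈ univ.erase v, ∑ x ∈ univ.erase v, g col u x :=
    sum_congr rfl fun u hu => sum_congr rfl fun x hx => by
      simp only [g, Function.update_of_ne (ne_of_mem_erase hu),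
        Function.update_of_ne (ne_of_mem_erase hx)]
  have hold : ∑ x, g col v x = #{x | G.Adj v x ∧ col x = col v} := by
    rw [card_filter]
  have hnew : ∑ x, g (Function.update col v c) v x = #{x | G.Adj v x ∧ col x = c} := by
    rw [card_filter]
    refine sum_congr rfl fun x _ => ?_
    by_cases hx : x = v
    · simp [g, hx]
    · simp [g, Function.update_of_ne hx]
  omega

/-- A relation with at most one successor per vertex, along which a bounded rank increases, is
`2`-colourable: colour the vertices in the order of decreasing rank. -/
lemma exists_bool_coloring_of_rank {V : Type*} {r : V → V → Prop} {rank : V → ℕ} {N : ℕ}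
    (hr : ∀ u w w', r u w → r u w' → w = w') (hlt : ∀ u w, r u w → rank u < rank w)
    (hN : ∀ u, rank u < N) : ∃ κ : V → Bool, ∀ u w, r u w → κ u ≠ κ w := by
  have key : ∀ n, ∃ κ : V → Bool, ∀ u w, r u w → N ≤ rank u + n → κ u ≠ κ w := by
    intro n
    induction n with
    | zero => exact ⟨fun _ => true, fun u _ _ h => absurd (hN u) (by omega)⟩
    | succ n ih =>
      obtain ⟨κ, hκ⟩ := ih
      refine ⟨fun u => if N ≤ rank u + n then κ u else
        if h : ∃ w, r u w then !κ h.choose else true, fun u w huw hu => ?_⟩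
      have hw : N ≤ rank w + n := by have := hlt u w huw; omega
      dsimp only
      rw [if_pos hw]
      by_cases hu' : N ≤ rank u + n
      · rw [if_pos hu']
        exact hκ u w huw hu'
      · have h : ∃ w, r u w := ⟨w, huw⟩
        rw [if_neg hu', dif_pos h, hr u _ _ h.choose_spec huw]
        simp
  obtain ⟨κ, hκ⟩ := key N
  exact ⟨κ, fun u w huw => hκ u w huw (by omega)⟩

/-- `v` has no neighbour of its own colour. -/
def IsFree {V : Type*} (G : SimpleGraph V) (col : V → Fin 15) (v : V) : Prop :=
  ∀ x, G.Adj v x → col x ≠ col v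

/-- Every bichromatic edge is owned by exactly one of its ends. A vertex that is not free owns its
edges to free vertices; between free vertices the smaller colour owns the edge; between vertices
that are not free, `u` owns the edge if the colour of `w` is among the seven colours following that
of `u` cyclically. The relation means that `u` owns the edge `uw`. -/
def Owns {V : Type*} (G : SimpleGraph V) (col : V → Fin 15) (u w : V) : Prop :=
  G.Adj u w ∧ col w ≠ col u ∧
    ((IsFree G col u ∧ IsFree G col w ∧ col u < col w) ∨
      (¬ IsFree G col u ∧ (IsFree G col w ∨ (col w - col u).val ≤ 7)))

lemma cyclic_tournament : ∀ a b : Fin 15, b ≠ a → ((b - a).val ≤ 7 ↔ ¬ (a - b).val ≤ 7) := by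
  decide

lemma owns_or_owns {V : Type*} {G : SimpleGraph V} {col : V → Fin 15} {u w : V} (h : G.Adj u w)
    (hc : col w ≠ col u) : Owns G col u w ∨ Owns G col w u := by
  have h1 := cyclic_tournament (col u) (col w) hc
  have h2 := lt_or_gt_of_ne hc
  have h3 := h.symm
  have h4 := hc.symm
  unfold Owns
  tauto

lemma not_owns_of_owns {V : Type*} {G : SimpleGraph V} {col : V → Fin 15} {u w : V}
    (h : Owns G col u w) :
    ¬ Owns G col w u := by
  have h1 := cyclic_tournament (col u) (col w) h.2.1
  have h2 : col u < col w → ¬ col w < col u := fun h => h.asymm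
  unfold Owns at *
  tauto

lemma seven_mul_le_card_owns {G : SimpleGraph V} {col : V → Fin 15}
    (hcol : ∀ v c, #{x | G.Adj v x ∧ col x = col v} ≤ #{x | G.Adj v x ∧ col x = c})
    {v : V} (hv : ¬ IsFree G col v) :
    7 * #{x | G.Adj v x ∧ col x = col v} ≤ #{x | Owns G col v x} := by
  have h7 : ∀ a : Fin 15, #{c : Fin 15 | c ≠ a ∧ (c - a).val ≤ 7} = 7 := by decide
  let A : Finset V := {x | G.Adj v x ∧ col x ≠ col v ∧ (col x - col v).val ≤ 7}
  have hA : A ⊆ univ.filter (fun x => Owns G col v x) := fun x hx => by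
    simp only [A, mem_filter, mem_univ, true_and] at hx ⊢
    exact ⟨hx.1, hx.2.1, Or.inr ⟨hv, Or.inr hx.2.2⟩⟩
  refine le_trans ?_ (card_le_card hA)
  have hmaps : ∀ x ∈ A, col x ∈ ({c : Fin 15 | c ≠ col v ∧ (c - col v).val ≤ 7} : Finset (Fin 15)) :=
    fun x hx => by
      simp only [A, mem_filter, mem_univ, true_and] at hx ⊢
      exact hx.2
  rw [card_eq_sum_card_fiberwise hmaps]
  have hfib : ∀ c ∈ ({c : Fin 15 | c ≠ col v ∧ (c - col v).val ≤ 7} : Finset (Fin 15)),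
      #{x | G.Adj v x ∧ col x = col v} ≤ #{x ∈ A | col x = c} := fun c hc => by
    refine (hcol v c).trans (card_le_card fun x hx => ?_)
    simp only [A, mem_filter, mem_univ, true_and] at hx hc ⊢
    exact ⟨⟨hx.1, hx.2 ▸ hc.1, hx.2 ▸ hc.2⟩, hx.2⟩
  have := card_nsmul_le_sum _ _ _ hfib
  rwa [h7, smul_eq_mul] at this

/-- `v` is free and owns exactly one edge. These edges are kept apart, as they could be isolated
edges of a colour part. -/
def IsSmall (G : SimpleGraph V) (col : V → Fin 15) (v : V) : Prop :=
  IsFree G col v ∧ #{x | Owns G col v x} = 1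

/-- The part of colour `i`: the edges inside the colour class `i`, and the edges owned by vertices
of colour `i` that are not small. -/
def colorPart (G : SimpleGraph V) (col : V → Fin 15) (i : Fin 15) : SimpleGraph V where
  Adj u w := G.Adj u w ∧ ((col u = i ∧ col w = i) ∨
    (col u = i ∧ Owns G col u w ∧ ¬ IsSmall G col u) ∨
    (col w = i ∧ Owns G col w u ∧ ¬ IsSmall G col w))
  symm := ⟨fun u w h => ⟨h.1.symm, by have := h.2; tauto⟩⟩
  loopless := ⟨fun _ h => G.irrefl h.1⟩

/-- The edges owned by small vertices. -/
def smallPart (G : SimpleGraph V) (col : V → Fin 15) : SimpleGraph V where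
  Adj u w := (Owns G col u w ∧ IsSmall G col u) ∨ (Owns G col w u ∧ IsSmall G col w)
  symm := ⟨fun _ _ h => h.symm⟩
  loopless := ⟨fun _ h => h.elim (fun h => G.irrefl h.1.1) fun h => G.irrefl h.1.1⟩

lemma fulfills123_colorPart {G : SimpleGraph V} {col : V → Fin 15}
    (hcol : ∀ v c, #{x | G.Adj v x ∧ col x = col v} ≤ #{x | G.Adj v x ∧ col x = c})
    (i : Fin 15) : Fulfills123 (colorPart G col i) := by
  obtain ⟨S, hS⟩ : ∃ S : Set V, ∀ x, x ∈ S ↔ col x = i := ⟨{x | col x = i}, fun _ => Iff.rfl⟩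
  refine fulfills123_of_independent_compl _ S ?_ ?_
  · rintro u v ⟨-, h⟩
    rw [hS, hS]
    tauto
  · intro s hs
    obtain rfl := (hS s).1 hs
    have hin : #{x | (colorPart G col (col s)).Adj s x ∧ x ∈ S} =
        #{x | G.Adj s x ∧ col x = col s} := by
      congr 1
      ext x
      simp only [mem_filter, mem_univ, true_and, hS, colorPart]
      tauto
    have hout : ¬ IsSmall G col s →
        #{x | (colorPart G col (col s)).Adj s x ∧ x ∉ S} =
          #{x | Owns G col s x} := by
      intro hs
      congr 1
      ext x
      simp only [mem_filter, mem_univ, true_and, hS, colorPart]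
      have h1 : Owns G col s x → G.Adj s x ∧ col x ≠ col s := fun h => ⟨h.1, h.2.1⟩
      tauto
    have hout' : IsSmall G col s →
        #{x | (colorPart G col (col s)).Adj s x ∧ x ∉ S} = 0 := by
      intro hs
      rw [card_eq_zero, filter_eq_empty_iff]
      rintro x - ⟨⟨-, h⟩, hx⟩
      rw [hS] at hx
      tauto
    rw [hin]
    by_cases hfree : IsFree G col s
    · right
      refine ⟨?_, fun h => ?_⟩
      · rw [card_eq_zero, filter_eq_empty_iff]
        exact fun x _ hx => hfree x hx.1 hx.2
      · by_cases hs : IsSmall G col s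
        · rw [hout' hs] at h
          omega
        · rw [hout hs] at h
          exact (hs ⟨hfree, h⟩).elim
    · left
      rw [hout fun h => hfree h.1]
      have h1 := seven_mul_le_card_owns hcol hfree
      have h2 : 1 ≤ #{x | G.Adj s x ∧ col x = col s} := by
        simp only [IsFree, not_forall, not_not] at hfree
        obtain ⟨x, hx, hxs⟩ := hfree
        exact card_pos.2 ⟨x, by simp [hx, hxs]⟩
      omega

/-- A small vertex is free, so it owns an edge only to a free vertex of larger colour; hence the
edges owned by small vertices form a forest. -/
lemma smallPart_colorable (G : SimpleGraph V) (col : V → Fin 15) :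
    ∃ κ : V → Bool, ∀ u v, (smallPart G col).Adj u v → κ u ≠ κ v := by
  have huniq : ∀ u w w', Owns G col u w ∧ IsSmall G col u → Owns G col u w' ∧ IsSmall G col u →
      w = w' := by
    rintro u w w' ⟨h, hu⟩ ⟨h', -⟩
    exact card_le_one.1 hu.2.le w (by simpa using h) w' (by simpa using h')
  have hlt : ∀ u w, Owns G col u w ∧ IsSmall G col u → (col u).val < (col w).val := by
    rintro u w ⟨⟨-, -, h⟩, hu⟩
    exact (h.resolve_right fun h => h.1 hu.1).2.2
  obtain ⟨κ, hκ⟩ := exists_bool_coloring_of_rank huniq hlt fun u => (col u).isLt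
  refine ⟨κ, ?_⟩
  rintro u v (h | h)
  · exact hκ u v h
  · exact (hκ v u h).symm

/-- Every finite graph decomposes into `15` graphs fulfilling the 1-2-3 Conjecture and a bipartite
graph. -/
theorem exists_decomposition_bipartite_rest (G : SimpleGraph V) :
    ∃ H : Option (Fin 15) → SimpleGraph V, IsDecomposition G H ∧
      (∀ i, Fulfills123 (H (some i))) ∧
      ∃ κ : V → Bool, ∀ u v, (H none).Adj u v → κ u ≠ κ v := by
  obtain ⟨col, hcol⟩ := exists_coloring_card_le G 15
  have hG : ∀ {u v}, Owns G col u v → G.Adj u v ∧ col v ≠ col u := fun h => ⟨h.1, h.2.1⟩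
  refine ⟨fun o => o.elim (smallPart G col) (colorPart G col), isDecomposition_of_adj ?_ ?_ ?_,
    fun i => fulfills123_colorPart hcol i, smallPart_colorable G col⟩
  · rintro (_ | i) u v h
    · exact h.elim (fun h => h.1.1) fun h => h.1.1.symm
    · exact h.1
  · intro u v huv
    by_cases hc : col v = col u
    · exact ⟨some (col u), huv, Or.inl ⟨rfl, hc⟩⟩
    · rcases owns_or_owns huv hc with h | h
      · by_cases hs : IsSmall G col u
        · exact ⟨none, Or.inl ⟨h, hs⟩⟩
        · exact ⟨some (col u), huv, Or.inr (Or.inl ⟨rfl, h, hs⟩)⟩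
      · by_cases hs : IsSmall G col v
        · exact ⟨none, Or.inr ⟨h, hs⟩⟩
        · exact ⟨some (col v), huv, Or.inr (Or.inr ⟨rfl, h, hs⟩)⟩
  · have hdisj : ∀ i u v, (smallPart G col).Adj u v → ¬ (colorPart G col i).Adj u v := by
      rintro i u v h ⟨-, h'⟩
      have h1 := @not_owns_of_owns V G col u v
      have h2 := @hG u v
      have h3 := @hG v u
      simp only [smallPart] at h
      grind
    rintro (_ | i) (_ | j) u v h h'
    · rfl
    · exact (hdisj j u v h h').elim
    · exact (hdisj i u v h' h).elim
    · have h1 := @not_owns_of_owns V G col u v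
      have h2 := @hG u v
      have h3 := @hG v u
      obtain ⟨-, h⟩ := h
      obtain ⟨-, h'⟩ := h'
      congr 1
      grind

end

/-! ### An independent set meeting enough edges to connect the graph -/

/-- The spanning subgraph formed by the edges of `G` with at least one end in `I`. -/
def edgesMeeting {V : Type*} (G : SimpleGraph V) (I : Set V) : SimpleGraph V where
  Adj u v := G.Adj u v ∧ (u ∈ I ∨ v ∈ I)
  symm := ⟨fun _ _ h => ⟨h.1.symm, h.2.symm⟩⟩
  loopless := ⟨fun _ h => G.irrefl h.1⟩

lemma edgesMeeting_mono {V : Type*} (G : SimpleGraph V) {I J : Set V} (h : I ⊆ J) :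
    edgesMeeting G I ≤ edgesMeeting G J :=
  fun _ _ huv => ⟨huv.1, huv.2.imp (@h _) (@h _)⟩

/-- There is an independent set `I` such that the edges meeting `I`, which form a bipartite graph,
connect the components of `G`. Take `I` maximal such that the edges meeting `I` connect whatever is
connected in `G` among the vertices of `D I`, that is, `I` and its neighbours; if `D I` is not
everything, `I` is enlarged by a vertex at distance two, or by one of a new component. -/
theorem exists_connecting_independent_set {V : Type*} [Finite V] (G : SimpleGraph V) :
    ∃ I : Set V, (∀ u ∈ I, ∀ v ∈ I, ¬ G.Adj u v) ∧
      ∀ u v, G.Adj u v → (edgesMeeting G I).Reachable u v := by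
  let D : Set V → Set V := fun I => {v | v ∈ I ∨ ∃ u ∈ I, G.Adj u v}
  let Φ : Set V → Prop := fun I => (∀ u ∈ I, ∀ v ∈ I, ¬ G.Adj u v) ∧
    ∀ u ∈ D I, ∀ v ∈ D I, G.Reachable u v → (edgesMeeting G I).Reachable u v
  obtain ⟨I, hI⟩ := (Set.toFinite {I | Φ I}).exists_maximal ⟨∅, by simp [Φ, D]⟩
  obtain ⟨hind, hreach⟩ := hI.prop
  suffices hD : ∀ v, v ∈ D I from
    ⟨I, hind, fun u v huv => hreach u (hD u) v (hD v) huv.reachable⟩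
  by_contra! hD
  obtain ⟨w, hw, hwD⟩ : ∃ w ∉ D I, (∃ x ∈ D I, G.Reachable w x) → ∃ x ∈ D I, G.Adj w x := by
    by_cases h : ∃ w ∉ D I, ∃ x ∈ D I, G.Adj w x
    · obtain ⟨w, hw, h⟩ := h
      exact ⟨w, hw, fun _ => h⟩
    · obtain ⟨w, hw⟩ := hD
      refine ⟨w, hw, ?_⟩
      rintro ⟨x, hx, ⟨p⟩⟩
      obtain ⟨d, -, hd1, hd2⟩ := p.exists_boundary_dart (D I)ᶜ hw (by simpa using hx)
      exact (h ⟨d.fst, hd1, d.snd, by simpa using hd2, d.adj⟩).elim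
  have hwI : w ∉ I := fun h => hw (Or.inl h)
  have hmono := edgesMeeting_mono G (Set.subset_insert w I)
  have hnew : ∀ a, a ∈ D (insert w I) → a ∉ D I →
      (edgesMeeting G (insert w I)).Reachable w a := by
    rintro a (ha | ⟨u, hu, hua⟩) ha'
    · rcases ha with rfl | ha
      · rfl
      · exact (ha' (Or.inl ha)).elim
    · rcases hu with rfl | hu
      · exact SimpleGraph.Adj.reachable ⟨hua, Or.inl (Set.mem_insert _ _)⟩
      · exact (ha' (Or.inr ⟨u, hu, hua⟩)).elim
  have hmix : ∀ a, a ∈ D (insert w I) → a ∉ D I → ∀ b ∈ D I, G.Reachable a b →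
      (edgesMeeting G (insert w I)).Reachable a b := by
    intro a ha ha' b hb hab
    have hwa := hnew a ha ha'
    have hle : edgesMeeting G (insert w I) ≤ G := fun _ _ h => h.1
    have hwb : G.Reachable w b := (hwa.mono hle).trans hab
    obtain ⟨x, hx, hwx⟩ := hwD ⟨b, hb, hwb⟩
    have hxb := (hreach x hx b hb (hwx.symm.reachable.trans hwb)).mono hmono
    have hwx' : (edgesMeeting G (insert w I)).Adj w x := ⟨hwx, Or.inl (Set.mem_insert _ _)⟩
    exact hwa.symm.trans (hwx'.reachable.trans hxb)
  have hΦ : Φ (insert w I) := by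
    refine ⟨?_, ?_⟩
    · rintro u (rfl | hu) v (rfl | hv) huv
      · exact G.irrefl huv
      · exact hw (Or.inr ⟨v, hv, huv.symm⟩)
      · exact hw (Or.inr ⟨u, hu, huv⟩)
      · exact hind u hu v hv huv
    · intro a ha b hb hab
      by_cases ha' : a ∈ D I <;> by_cases hb' : b ∈ D I
      · exact (hreach a ha' b hb' hab).mono hmono
      · exact (hmix b hb hb' a ha' hab.symm).symm
      · exact hmix a ha ha' b hb' hab
      · exact (hnew a ha ha').symm.trans (hnew b hb hb')
  exact hwI (hI.le_of_ge hΦ (Set.subset_insert w I) (Set.mem_insert w I))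

/-- The edges of `G` inside `U`, as a graph on all of `V`. -/
def restrict {V : Type*} (G : SimpleGraph V) (U : Set V) : SimpleGraph V where
  Adj u v := G.Adj u v ∧ u ∈ U ∧ v ∈ U
  symm := ⟨fun _ _ h => ⟨h.1.symm, h.2.2, h.2.1⟩⟩
  loopless := ⟨fun _ h => G.irrefl h.1⟩

lemma even_length_iff_of_edgesMeeting {V : Type*} {G : SimpleGraph V} {I : Set V}
    (hI : ∀ u ∈ I, ∀ v ∈ I, ¬ G.Adj u v) {u v : V} (p : (edgesMeeting G I).Walk u v) :
    Even p.length ↔ (u ∈ I ↔ v ∈ I) := by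
  induction p with
  | nil => simp
  | @cons a b c h p ih =>
    have h1 : a ∈ I → b ∉ I := fun ha hb => hI a ha b hb h.1
    have h2 := h.2
    rw [SimpleGraph.Walk.length_cons, Nat.even_add_one, ih]
    tauto

end OneTwoThree

/-! ### The decomposition -/

open OneTwoThree in
theorem mainTheorem2 {V : Type*} [Finite V] (G : SimpleGraph V)
    (hG : OneTwoThree.NoIsolatedEdges G) :
    ∃ H : Fin 24 → SimpleGraph V,
      OneTwoThree.IsDecomposition G H ∧ ∀ i, OneTwoThree.Fulfills123 (H i) := by
  have := Fintype.ofFinite V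
  obtain ⟨I, hI, hreach⟩ := exists_connecting_independent_set G
  obtain ⟨H, hH, hHf, κ, hκ⟩ := exists_decomposition_bipartite_rest (restrict G Iᶜ)
  have hHadj : ∀ {i u v}, (H i).Adj u v → (restrict G Iᶜ).Adj u v := fun {i u v} h => by
    have : s(u, v) ∈ ⋃ i, (H i).edgeSet := Set.mem_iUnion.2 ⟨i, h⟩
    rwa [hH.2] at this
  let Q : SimpleGraph V := edgesMeeting G I ⊔ H none
  have hQ1 : ∀ {u v}, (edgesMeeting G I).Adj u v → Q.Adj u v := Or.inl
  -- an edge of `H none` closes an even walk through edges meeting `I`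
  have hodd : ∀ u v, (H none).Adj u v → u ∈ oddPart Q := by
    intro u v huv
    obtain ⟨huv', hu, hv⟩ := hHadj huv
    obtain ⟨p⟩ := (hreach u v huv').symm
    have hp : Even p.length := (even_length_iff_of_edgesMeeting hI p).2 (iff_of_false hv hu)
    refine ⟨SimpleGraph.Walk.cons (Or.inr huv) (p.mapLe le_sup_left), ?_⟩
    simpa using hp.add_one
  let H' : Option (Option (Fin 15)) → SimpleGraph V := fun o =>
    o.elim (restrict Q (oddPart Q)) fun o =>
      o.elim (restrict Q (oddPart Q)ᶜ) fun i => H (some i)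
  have hQ2 : ∀ u v, (restrict Q (oddPart Q)ᶜ).Adj u v → (edgesMeeting G I).Adj u v := by
    rintro u v ⟨h | h, hu, -⟩
    · exact h
    · exact (hu (hodd u v h)).elim
  have hQH : ∀ i u v, Q.Adj u v → ¬ (H (some i)).Adj u v := by
    rintro i u v (h | h) h'
    · have := (hHadj h').2
      exact h.2.elim this.1 this.2
    · exact Set.disjoint_left.1 (hH.1 none (some i) (by simp)) (show s(u, v) ∈ _ from h) h'
  have hdec : IsDecomposition G H' := by
    refine isDecomposition_of_adj ?_ ?_ ?_
    · have hQG : ∀ u v, Q.Adj u v → G.Adj u v := fun u v h => h.elim And.left fun h => (hHadj h).1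
      rintro (_ | _ | i) u v h
      · exact hQG u v h.1
      · exact hQG u v h.1
      · exact (hHadj h).1
    · intro u v huv
      have hcase : Q.Adj u v ∨ ∃ i, (H (some i)).Adj u v := by
        by_cases h : u ∈ I ∨ v ∈ I
        · exact Or.inl (Or.inl ⟨huv, h⟩)
        · have : s(u, v) ∈ (restrict G Iᶜ).edgeSet :=
            ⟨huv, fun hu => h (Or.inl hu), fun hv => h (Or.inr hv)⟩
          rw [← hH.2] at this
          obtain ⟨_ | i, hi⟩ := Set.mem_iUnion.1 this
          · exact Or.inl (Or.inr hi)
          · exact Or.inr ⟨i, hi⟩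
      rcases hcase with h | ⟨i, h⟩
      · by_cases hu : u ∈ oddPart Q
        · exact ⟨none, h, hu, mem_oddPart_of_adj h hu⟩
        · exact ⟨some none, h, hu, fun hv => hu (mem_oddPart_of_adj h.symm hv)⟩
      · exact ⟨some (some i), h⟩
    · rintro (_ | _ | i) (_ | _ | j) u v h h'
      · rfl
      · exact (h'.2.1 h.2.1).elim
      · exact (hQH j u v h.1 h').elim
      · exact (h.2.1 h'.2.1).elim
      · rfl
      · exact (hQH j u v h.1 h').elim
      · exact (hQH i u v h'.1 h).elim
      · exact (hQH i u v h'.1 h).elim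
      · by_contra hij
        exact Set.disjoint_left.1 (hH.1 (some i) (some j) fun e => hij (congrArg some e))
          (show s(u, v) ∈ _ from h) h'
  refine exists_fin_decomposition (by simp) hdec ?_
  rintro (_ | _ | i)
  · refine fulfills123_of_zmod_coloring Q _
      (fun v => open scoped Classical in if v ∈ I then 0 else if κ v then 1 else 2) ?_ ?_
    · rintro u v (⟨h, huv⟩ | h)
      · have h1 : u ∈ I → v ∉ I := fun hu hv => hI u hu v hv h
        by_cases hu : u ∈ I
        · rw [if_pos hu, if_neg (h1 hu)]
          split_ifs <;> decide
        · rw [if_neg hu, if_pos (huv.resolve_left hu)]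
          split_ifs <;> decide
      · obtain ⟨-, hu, hv⟩ := hHadj h
        have hne := hκ u v h
        rw [if_neg hu, if_neg hv]
        cases hu' : κ u <;> cases hv' : κ v <;> simp_all <;> decide
    · exact fun u v => ⟨fun h => ⟨h.1, h.2.1⟩, fun h => ⟨h.1, h.2, mem_oddPart_of_adj h.1 h.2⟩⟩
  · refine fulfills123_of_bipartite _ I (fun u v h => ?_) ?_
    · have h := hQ2 u v h
      have h1 : u ∈ I → v ∉ I := fun hu hv => hI u hu v hv h.1
      have := h.2
      tauto
    · rintro ⟨u, v, huv, hu, hv⟩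
      -- `{u, v}` is closed under the edges meeting `I`, hence a component of `G`
      have hclosed : ∀ x y, (edgesMeeting G I).Adj x y → x = u ∨ x = v → y = u ∨ y = v := by
        rintro x y h (rfl | rfl)
        · exact Or.inr (hu y ⟨hQ1 h, huv.2.1, fun hy => huv.2.1 (mem_oddPart_of_adj (hQ1 h).symm hy)⟩)
        · exact Or.inl (hv y ⟨hQ1 h, huv.2.2, fun hy => huv.2.2 (mem_oddPart_of_adj (hQ1 h).symm hy)⟩)
      have hwalk : ∀ x y, (edgesMeeting G I).Walk x y → x = u ∨ x = v → y = u ∨ y = v := by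
        intro x y p
        induction p with
        | nil => exact id
        | cons h _ ih => exact fun hx => ih (hclosed _ _ h hx)
      refine hG ⟨u, v, (hQ2 u v huv).1, fun w hw => ?_, fun w hw => ?_⟩
      · obtain ⟨p⟩ := hreach u w hw
        exact (hwalk _ _ p (Or.inl rfl)).resolve_left hw.ne'
      · obtain ⟨p⟩ := hreach v w hw
        exact (hwalk _ _ p (Or.inr rfl)).resolve_right hw.ne'
  · exact hHf i
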